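/- Let $H\in(0,1)$ and $c>0$. Then there is a constant $\kappa_H>0$, depending only on $H$ and $c$, with the following property. Let $Z=\{Z_t,\ t\ge 0\}$ be a real-valued centered Gaussian process that is self-similar with index $H$, i.e. for every $a>0$ the processes $\{Z_{at}\}_{t\ge0}$ and $\{a^H Z_t\}_{t\ge0}$ have the same finite-dimensional distributions. For $t\in\mathbb{R}$ put $Y_t=e^{-Ht}Z_{e^t}$ and $r(t)=\mathbb{E}[Y_0Y_t]$. Suppose that $r$ is nonnegative and decreasing (in the weak sense) on $[0,\infty)$, that $r\in L^1(\mathbb{R})$, and that $$\int_0^\infty r(t)\cos(t\lambda)\,dt\ \ge\ \frac{c}{(|\lambda|+1)^{1+2H}}\qquad\text{for all }\lambda\in\mathbb{R}.$$ Then for every integer $m\ge1$ and all times $s_1,\dots,s_m,t\in(0,\infty)$, almost surely, $$\operatorname{Var}\big(Z_t\,\big|\,Z_{s_1},\dots,Z_{s_m}\big)\ \ge\ \kappa_H\,\min\big\{|t-s_1|^{2H},\dots,|t-s_m|^{2H},\,t^{2H}\big\}.$$ -/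

import Mathlib

open MeasureTheory ProbabilityTheory
open scoped NNReal

/-- The process `Z = {Z_t, t ≥ 0}` is self-similar with index `H` under `P`: for every `a > 0` the
processes `{Z_{at}, t ≥ 0}` and `{a^H Z_t, t ≥ 0}` have the same finite-dimensional laws. -/
def IsSelfSimilar {Ω : Type*} [MeasurableSpace Ω] (H : ℝ) (Z : ℝ≥0 → Ω → ℝ)
    (P : Measure Ω) : Prop :=
  ∀ a : ℝ≥0, 0 < a → ∀ I : Finset ℝ≥0,
    IdentDistrib (fun ω ↦ I.restrict (fun t ↦ Z (a * t) ω))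
      (fun ω ↦ I.restrict (fun t ↦ (a : ℝ) ^ H * Z t ω)) P P

/-- The Lamperti transform `Y_t = e^{-Ht} Z_{e^t}`, `t ∈ ℝ`, of a process `Z` on `[0, ∞)`. -/
noncomputable def lamperti {Ω : Type*} (H : ℝ) (Z : ℝ≥0 → Ω → ℝ) (t : ℝ) (ω : Ω) : ℝ :=
  Real.exp (-H * t) * Z ⟨Real.exp t, (Real.exp_pos t).le⟩ ω

/-- The covariance function `r(t) = E[Y_0 Y_t]` of the Lamperti transform `Y` of a centered
process `Z`. -/
noncomputable def lampertiCov {Ω : Type*} [MeasurableSpace Ω] (H : ℝ) (Z : ℝ≥0 → Ω → ℝ)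
    (P : Measure Ω) (t : ℝ) : ℝ :=
  ∫ ω, lamperti H Z 0 ω * lamperti H Z t ω ∂P

/-- The σ-algebra generated by the random variables `Z_{s_1}, …, Z_{s_m}`. -/
abbrev sigmaGenerated {Ω : Type*} {m : ℕ} (Z : ℝ≥0 → Ω → ℝ) (s : Fin m → ℝ≥0) :
    MeasurableSpace Ω :=
  ⨆ j : Fin m, MeasurableSpace.comap (Z (s j)) inferInstance

/-! By Gaussianity the conditional variance is a constant: the second moment of a residual `Z_t - ∑
a_j Z_{s_j}` (`IsGaussianProcess.exists_condVar_ae_eq`). It therefore suffices to bound below the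
variance of every such combination, uniformly in the coefficients.

Since `Z_τ = τ^H Y_{log τ}` with `Y` stationary, this variance is `t^{2H}` times a quadratic form in
`r(u_i - u_j)`, where the `u_i` are the logarithms of the times and the coefficient at `log t` is 1.
As `r` has a nonnegative integrable spectral density `R`, up to a possible jump of `r` at 0 that
only adds variance, the form dominates `∫ R |S|²` with `S` a trigonometric sum.

If `log t` is `δ`-separated from the other frequencies, a test function at scale `δ` recovers its
coefficient 1 from `S`. Cauchy-Schwarz against the decay bound on `R` then gives `∫ R |S|² ≥ δ^{2H}
/ A` (`exists_lower_bound_integral_mul_normSq`). Separation of the times relative to `t` yields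
separation of the logarithms, and `t^{2H} δ^{2H}` is the claimed minimum up to a constant. -/

/-! ### Spectral density and Fourier inversion -/

open Real Filter Topology FourierTransform in
/-- A bounded integrable function with nonnegative Fourier transform has an integrable Fourier
transform. -/
theorem integrable_of_fourier_nonneg {f : ℝ → ℂ} {R : ℝ → ℝ} {M : ℝ} (hf : Integrable f)
    (hM : ∀ x, ‖f x‖ ≤ M) (hR : ∀ w, 𝓕 f w = (R w : ℂ)) (hR0 : ∀ w, 0 ≤ R w) :
    Integrable R ∧ ∫ w, R w ≤ M := by
  have hRc : Continuous R := by
    have h : Continuous (𝓕 f) :=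
      VectorFourier.fourierIntegral_continuous Real.continuous_fourierChar
        (by exact continuous_inner) hf
    have h2 : R = fun w ↦ (𝓕 f w).re := by ext w; simp [hR]
    rw [h2]
    exact Complex.continuous_re.comp h
  have hbound : ∀ w, |R w| ≤ ∫ x, ‖f x‖ := by
    intro w
    have := VectorFourier.norm_fourierIntegral_le_integral_norm Real.fourierChar volume
      (innerₗ ℝ) f w
    have h2 : ‖𝓕 f w‖ ≤ ∫ x, ‖f x‖ := this
    rwa [hR, Complex.norm_real] at h2
  -- Gaussian means
  let b : ℕ → ℝ := fun n ↦ 1 / ((n : ℝ) + 1)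
  have hb : ∀ n, 0 < b n := fun n ↦ by positivity
  let G : ℕ → ℝ → ℝ := fun n w ↦ rexp (-(π * b n) * w ^ 2) * R w
  have hGint : ∀ n, Integrable (G n) := by
    intro n
    have h1 := integrable_exp_neg_mul_sq (b := π * b n) (mul_pos pi_pos (hb n))
    refine h1.mul_bdd (c := ∫ x, ‖f x‖) hRc.aestronglyMeasurable (ae_of_all _ fun w ↦ hbound w)
  have hG0 : ∀ n w, 0 ≤ G n w := fun n w ↦ mul_nonneg (exp_pos _).le (hR0 w)
  have hGle : ∀ n, ∫ w, G n w ≤ M := by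
    intro n
    let g : ℝ → ℂ := fun x ↦ Complex.exp (-π * (b n : ℂ) * x ^ 2)
    have hgint : Integrable g := by
      have := integrable_cexp_neg_mul_sq (b := (π * b n : ℝ)) (by
        simpa using mul_pos pi_pos (hb n))
      simpa [g] using this
    have hg : 𝓕 g = fun t : ℝ ↦ ((√((b n)⁻¹) * rexp (-(π / b n) * t ^ 2) : ℝ) : ℂ) := by
      have := fourier_gaussian_pi (b := (b n : ℂ)) (by simpa using hb n)
      rw [this]
      ext t
      push_cast
      congr 1
      · rw [one_div, Real.sqrt_eq_rpow, Complex.ofReal_cpow (inv_pos.2 (hb n)).le,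
          Complex.ofReal_inv, Complex.inv_cpow _ _ ?_]
        · norm_num
        · rw [Complex.arg_ofReal_of_nonneg (hb n).le]; exact pi_pos.ne
      · ring_nf
    -- Moving the transform onto the Gaussian turns the damped integral of `R` into a mean of `f`
    -- against a probability density, hence at most `M`; Fatou removes the damping.
    have key : ∫ w, 𝓕 f w • g w = ∫ x, f x • 𝓕 g x := by
      have := VectorFourier.integral_fourierIntegral_smul_eq_flip (L := innerₗ ℝ)
        (μ := volume) (ν := volume) (f := f) (g := g)
        continuous_fourierChar continuous_inner hf hgint
      simpa using! this
    have h1 : ((∫ w, G n w : ℝ) : ℂ) = ∫ w, 𝓕 f w • g w := by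
      rw [← integral_complex_ofReal]
      congr 1
      ext w
      simp only [G, g, hR, smul_eq_mul]
      push_cast
      ring_nf
    have hint1 : ∫ t, √((b n)⁻¹) * rexp (-(π / b n) * t ^ 2) = 1 := by
      rw [integral_const_mul, integral_gaussian, ← Real.sqrt_mul (inv_pos.2 (hb n)).le]
      have := (hb n).ne'
      have := pi_pos.ne'
      rw [show (b n)⁻¹ * (π / (π / b n)) = 1 by field_simp]
      simp
    have hint2 : Integrable fun t ↦ √((b n)⁻¹) * rexp (-(π / b n) * t ^ 2) :=
      (integrable_exp_neg_mul_sq (div_pos pi_pos (hb n))).const_mul _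
    calc ∫ w, G n w ≤ ‖((∫ w, G n w : ℝ) : ℂ)‖ := by
          rw [Complex.norm_real]; exact le_abs_self _
      _ = ‖∫ x, f x • 𝓕 g x‖ := by rw [h1, key]
      _ ≤ ∫ x, M * (√((b n)⁻¹) * rexp (-(π / b n) * x ^ 2)) := by
          refine norm_integral_le_of_norm_le (hint2.const_mul M) (ae_of_all _ fun x ↦ ?_)
          rw [norm_smul, hg, Complex.norm_real, Real.norm_of_nonneg (by positivity)]
          exact mul_le_mul_of_nonneg_right (hM x) (by positivity)
      _ = M := by rw [integral_const_mul, hint1, mul_one]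
  have hlim : ∀ w, Tendsto (fun n ↦ G n w) atTop (𝓝 (R w)) := by
    intro w
    have hb0 : Tendsto b atTop (𝓝 0) := tendsto_one_div_add_atTop_nhds_zero_nat
    have h : Tendsto (fun n ↦ rexp (-(π * b n) * w ^ 2) * R w) atTop
        (𝓝 (rexp (-(π * 0) * w ^ 2) * R w)) :=
      ((Real.continuous_exp.tendsto _).comp
        (((hb0.const_mul π).neg).mul_const _)).mul_const _
    simpa [G] using h
  have hM0 : 0 ≤ M := (norm_nonneg _).trans (hM 0)
  have hfatou : ∫⁻ w, ENNReal.ofReal (R w) ≤ ENNReal.ofReal M := by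
    calc ∫⁻ w, ENNReal.ofReal (R w)
        = ∫⁻ w, liminf (fun n ↦ ENNReal.ofReal (G n w)) atTop := by
          congr 1
          ext w
          exact ((ENNReal.continuous_ofReal.tendsto _).comp (hlim w)).liminf_eq.symm
      _ ≤ liminf (fun n ↦ ∫⁻ w, ENNReal.ofReal (G n w)) atTop :=
          lintegral_liminf_le' fun n ↦ (hGint n).aemeasurable.ennreal_ofReal
      _ ≤ ENNReal.ofReal M := by
          refine (liminf_le_liminf (v := fun _ ↦ ENNReal.ofReal M)
            (Eventually.of_forall fun n ↦ ?_)).trans (by simp)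
          rw [← ofReal_integral_eq_lintegral_ofReal (hGint n) (ae_of_all _ (hG0 n))]
          exact ENNReal.ofReal_le_ofReal (hGle n)
  have hRint : Integrable R := by
    refine ⟨hRc.aestronglyMeasurable, ?_⟩
    rw [hasFiniteIntegral_iff_ofReal (ae_of_all _ hR0)]
    exact hfatou.trans_lt ENNReal.ofReal_lt_top
  refine ⟨hRint, ?_⟩
  rw [← ofReal_integral_eq_lintegral_ofReal hRint (ae_of_all _ hR0)] at hfatou
  exact (ENNReal.ofReal_le_ofReal_iff hM0).1 hfatou

open Real Filter Topology FourierTransform in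
/-- Fourier inversion for an even integrable function which is nonnegative and decreasing on
`[0, ∞)`, with nonnegative cosine transform. -/
theorem fourier_inversion_of_antitoneOn {r : ℝ → ℝ} (heven : ∀ t, r (-t) = r t)
    (hr0 : ∀ t, 0 ≤ t → 0 ≤ r t) (hanti : AntitoneOn r (Set.Ici 0)) (hint : Integrable r)
    (hcos : ∀ ξ : ℝ, 0 ≤ ∫ t in Set.Ioi (0 : ℝ), r t * Real.cos (t * ξ)) :
    let R : ℝ → ℝ := fun w ↦ 2 * ∫ t in Set.Ioi (0 : ℝ), r t * Real.cos (t * (2 * π * w))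
    Integrable R ∧ ∫ w, R w ≤ r 0 ∧ ∀ t, t ≠ 0 → r t = ∫ w, R w * Real.cos (2 * π * w * t) := by
  intro R
  have habs : ∀ t, r t = r |t| := by
    intro t
    rcases abs_choice t with h | h <;> rw [h]
    rw [heven]
  have hnn : ∀ t, 0 ≤ r t := fun t ↦ by rw [habs]; exact hr0 _ (abs_nonneg t)
  have hle : ∀ t, r t ≤ r 0 := fun t ↦ by
    rw [habs]; exact hanti (by simp) (by simp) (abs_nonneg t)
  have hR : ∀ w, 𝓕 (fun t ↦ (r t : ℂ)) w = (R w : ℂ) := by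
    intro w
    have hexp : ∀ t : ℝ, Complex.exp ((-2 * π * t * w : ℝ) * Complex.I) * (r t : ℂ)
        = ((r t * Real.cos (t * (2 * π * w)) : ℝ) : ℂ)
          - ((r t * Real.sin (t * (2 * π * w)) : ℝ) : ℂ) * Complex.I := by
      intro t
      rw [Complex.exp_mul_I, show (-2 * π * t * w : ℝ) = -(t * (2 * π * w)) by ring]
      push_cast
      rw [Complex.cos_neg, Complex.sin_neg]
      ring
    have hc : Integrable fun t ↦ r t * Real.cos (t * (2 * π * w)) :=
      hint.mul_bdd (c := 1) (by fun_prop) (ae_of_all _ fun t ↦ Real.abs_cos_le_one _)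
    have hs : Integrable fun t ↦ r t * Real.sin (t * (2 * π * w)) :=
      hint.mul_bdd (c := 1) (by fun_prop) (ae_of_all _ fun t ↦ Real.abs_sin_le_one _)
    have hs0 : ∫ t, r t * Real.sin (t * (2 * π * w)) = 0 := by
      have h := integral_neg_eq_self (fun t ↦ r t * Real.sin (t * (2 * π * w))) volume
      simp only [heven, neg_mul, Real.sin_neg, mul_neg, integral_neg] at h
      linarith
    have hc2 : ∫ t, r t * Real.cos (t * (2 * π * w)) = R w := by
      have h := integral_comp_abs (f := fun t ↦ r t * Real.cos (t * (2 * π * w)))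
      refine Eq.trans ?_ h
      congr 1
      ext t
      rw [← habs]
      rcases abs_choice t with h | h <;> simp [h]
    rw [Real.fourier_real_eq_integral_exp_smul]
    simp only [smul_eq_mul, hexp]
    rw [integral_sub hc.ofReal (hs.ofReal.mul_const _), integral_mul_const,
      integral_complex_ofReal, integral_complex_ofReal, hs0, hc2]
    simp
  have hR0 : ∀ w, 0 ≤ R w := fun w ↦ mul_nonneg two_pos.le (hcos _)
  obtain ⟨hRi, hRle⟩ := integrable_of_fourier_nonneg hint.ofReal (M := r 0)
    (fun x ↦ by simpa [abs_of_nonneg (hnn x)] using hle x) hR hR0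
  refine ⟨hRi, hRle, ?_⟩
  let g : ℝ → ℝ := fun t ↦ ∫ w, R w * Real.cos (2 * π * w * t)
  have hgc : Continuous g := by
    refine continuous_of_dominated (bound := fun w ↦ ‖R w‖) (fun t ↦ ?_) (fun t ↦ ?_) hRi.norm ?_
    · exact hRi.aestronglyMeasurable.mul (by fun_prop)
    · refine ae_of_all _ fun w ↦ ?_
      rw [norm_mul]
      exact mul_le_of_le_one_right (norm_nonneg _) (Real.abs_cos_le_one _)
    · exact ae_of_all _ fun w ↦ by fun_prop
  have hinv : ∀ t, ContinuousAt r t → r t = g t := by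
    intro t ht
    have hF : 𝓕 (fun t ↦ (r t : ℂ)) = fun w ↦ (R w : ℂ) := funext hR
    have hf : Integrable fun t ↦ (r t : ℂ) := hint.ofReal
    have h := hf.fourierInv_fourier_eq (by rw [hF]; exact hRi.ofReal)
      (Complex.continuous_ofReal.continuousAt.comp ht)
    rw [hF, Real.fourierInv_eq'] at h
    have hi : Integrable fun w : ℝ ↦
        Complex.exp ((2 * π * inner ℝ w t : ℝ) * Complex.I) • (R w : ℂ) := by
      refine Integrable.bdd_mul (c := 1) hRi.ofReal (by fun_prop) (ae_of_all _ fun w ↦ ?_)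
      rw [Complex.norm_exp_ofReal_mul_I]
    have h2 := congrArg Complex.re h
    have h3 := integral_re hi
    simp only [RCLike.re_eq_complex_re] at h3
    rw [← h3] at h2
    rw [Complex.ofReal_re] at h2
    rw [← h2]
    refine integral_congr_ae (ae_of_all _ fun w ↦ ?_)
    simp only [smul_eq_mul, Complex.re_mul_ofReal, Complex.exp_ofReal_mul_I_re]
    rw [mul_comm]
    congr 2
    simp
    ring
  -- A monotone function has only countably many discontinuities; freezing `r` at `r 0` on the left
  -- makes it monotone on all of `ℝ`.
  have hdense : ∀ a b : ℝ, 0 ≤ a → a < b → ∃ s ∈ Set.Ioo a b, ContinuousAt r s := by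
    intro a b ha hab
    have hρ : Antitone fun t ↦ r (max t 0) := fun x y hxy ↦
      hanti (Set.mem_Ici.2 (le_max_right x 0)) (Set.mem_Ici.2 (le_max_right y 0))
        (max_le_max_right 0 hxy)
    obtain ⟨s, hs, hs'⟩ := (hρ.countable_not_continuousAt.dense_compl ℝ).exists_between hab
    refine ⟨s, hs', ?_⟩
    have hc : ContinuousAt (fun t ↦ r (max t 0)) s := by simpa using hs
    refine hc.congr ?_
    filter_upwards [lt_mem_nhds (ha.trans_lt hs'.1)] with x hx
    rw [max_eq_left hx.le]
  -- Continuity points accumulate at `t` from both sides, so monotonicity squeezes `r t` between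
  -- one-sided limits of the continuous `g`. At 0 this fails: `r` may jump there.
  have hpos : ∀ t, 0 < t → r t = g t := by
    intro t ht
    have hfr : ∃ᶠ s in 𝓝[>] t, g s ≤ r t := by
      rw [(nhdsGT_basis t).frequently_iff]
      intro b hb
      obtain ⟨s, hs, hc⟩ := hdense t b ht.le hb
      exact ⟨s, hs, by rw [← hinv s hc]; exact hanti ht.le (ht.trans hs.1).le hs.1.le⟩
    have hfl : ∃ᶠ s in 𝓝[<] t, r t ≤ g s := by
      rw [(nhdsLT_basis t).frequently_iff]
      intro b hb
      obtain ⟨s, hs, hc⟩ := hdense (max b 0) t (le_max_right _ _) (max_lt hb ht)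
      have hs0 : 0 < s := (le_max_right _ _).trans_lt hs.1
      exact ⟨s, ⟨(le_max_left _ _).trans_lt hs.1, hs.2⟩,
        by rw [← hinv s hc]; exact hanti hs0.le ht.le hs.2.le⟩
    refine le_antisymm ?_ ?_
    · by_contra! hlt
      exact hfl ((((hgc.tendsto t).mono_left nhdsWithin_le_nhds).eventually
        (gt_mem_nhds hlt)).mono fun s hs ↦ not_le.2 hs)
    · by_contra! hlt
      exact hfr ((((hgc.tendsto t).mono_left nhdsWithin_le_nhds).eventually
        (lt_mem_nhds hlt)).mono fun s hs ↦ not_le.2 hs)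
  intro t ht
  rcases lt_or_gt_of_ne ht with h | h
  · have h1 := hpos (-t) (by linarith)
    rw [heven] at h1
    simpa [g] using h1
  · exact hpos t h

/-! ### Quadratic forms and their spectral lower bound -/

open Complex in
/-- A weighted square of a trigonometric sum expands into a quadratic form of cosines. -/
theorem normSq_sum_mul_exp {ι : Type*} [Fintype ι] (b θ : ι → ℝ) :
    ‖∑ i, (b i : ℂ) * exp (θ i * I)‖ ^ 2
      = ∑ i, ∑ j, b i * b j * Real.cos (θ i - θ j) := by
  rw [Complex.sq_norm, Complex.normSq_apply]
  have hre : (∑ i, (b i : ℂ) * exp (θ i * I)).re = ∑ i, b i * Real.cos (θ i) := by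
    simp [Complex.re_sum, exp_ofReal_mul_I_re]
  have him : (∑ i, (b i : ℂ) * exp (θ i * I)).im = ∑ i, b i * Real.sin (θ i) := by
    simp [Complex.im_sum, exp_ofReal_mul_I_im]
  rw [hre, him, Finset.sum_mul_sum, Finset.sum_mul_sum, ← Finset.sum_add_distrib]
  refine Finset.sum_congr rfl fun i _ ↦ ?_
  rw [← Finset.sum_add_distrib]
  refine Finset.sum_congr rfl fun j _ ↦ ?_
  rw [Real.cos_sub]
  ring

/-- The quadratic form of the kernel `1_{u = v}` is nonnegative. -/
theorem sum_sum_ite_eq_nonneg {ι α : Type*} [Fintype ι] [DecidableEq α] (b : ι → ℝ) (u : ι → α) :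
    0 ≤ ∑ i, ∑ j, b i * b j * (if u i = u j then 1 else 0) := by
  -- Grouping the indices by the value of `u` gives a sum of squares.
  have h : ∑ i, ∑ j, b i * b j * (if u i = u j then 1 else 0)
      = ∑ v ∈ Finset.univ.image u, (∑ i, if u i = v then b i else 0) ^ 2 := by
    symm
    simp_rw [sq, Finset.sum_mul_sum]
    rw [Finset.sum_comm]
    refine Finset.sum_congr rfl fun i _ ↦ ?_
    rw [Finset.sum_comm]
    refine Finset.sum_congr rfl fun j _ ↦ ?_
    rw [Finset.sum_eq_single (u i)]
    · simp [eq_comm]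
    · intro v _ hv; simp [hv.symm]
    · simp
  rw [h]
  exact Finset.sum_nonneg fun _ _ ↦ sq_nonneg _

open Complex in
/-- Bochner-type lower bound for a quadratic form whose kernel is, off the diagonal, the cosine
transform of a density `R`. -/
theorem integral_mul_normSq_le_quadraticForm {ι : Type*} [Fintype ι] {r R : ℝ → ℝ}
    (hR : Integrable R) (h0 : ∫ w, R w ≤ r 0)
    (h : ∀ t, t ≠ 0 → r t = ∫ w, R w * Real.cos (2 * Real.pi * w * t)) (b u : ι → ℝ) :
    Integrable (fun w : ℝ ↦ R w * ‖∑ i, (b i : ℂ) * exp ((2 * Real.pi * w * u i : ℝ) * I)‖ ^ 2) ∧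
    ∫ w, R w * ‖∑ i, (b i : ℂ) * exp ((2 * Real.pi * w * u i : ℝ) * I)‖ ^ 2
      ≤ ∑ i, ∑ j, b i * b j * r (u i - u j) := by
  classical
  have hi : ∀ t : ℝ, Integrable fun w ↦ R w * Real.cos (2 * Real.pi * w * t) := fun t ↦
    hR.mul_bdd (c := 1) (by fun_prop) (ae_of_all _ fun w ↦ Real.abs_cos_le_one _)
  have hexp : ∀ w, R w * ‖∑ i, (b i : ℂ) * exp ((2 * Real.pi * w * u i : ℝ) * I)‖ ^ 2
      = ∑ i, ∑ j, b i * b j * (R w * Real.cos (2 * Real.pi * w * (u i - u j))) := by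
    intro w
    rw [normSq_sum_mul_exp, Finset.mul_sum]
    refine Finset.sum_congr rfl fun i _ ↦ ?_
    rw [Finset.mul_sum]
    refine Finset.sum_congr rfl fun j _ ↦ ?_
    rw [mul_sub]
    ring
  simp_rw [hexp]
  refine ⟨integrable_finsetSum _ fun i _ ↦ integrable_finsetSum _ fun j _ ↦
    (hi _).const_mul _, ?_⟩
  rw [integral_finsetSum _ fun i _ ↦ integrable_finsetSum _ fun j _ ↦ (hi _).const_mul _]
  simp_rw [integral_finsetSum _ fun j _ ↦ (hi (_ - u j)).const_mul _, integral_const_mul]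
  have hr : ∀ t, r t = (∫ w, R w * Real.cos (2 * Real.pi * w * t))
      + (r 0 - ∫ w, R w) * (if t = 0 then 1 else 0) := by
    intro t
    by_cases ht : t = 0
    · simp [ht]
    · simp [ht, h t ht]
  have hsum : ∑ i, ∑ j, b i * b j * r (u i - u j)
      = (∑ i, ∑ j, b i * b j * ∫ w, R w * Real.cos (2 * Real.pi * w * (u i - u j)))
        + (r 0 - ∫ w, R w) * ∑ i, ∑ j, b i * b j * (if u i = u j then 1 else 0) := by
    rw [Finset.mul_sum, ← Finset.sum_add_distrib]
    refine Finset.sum_congr rfl fun i _ ↦ ?_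
    rw [Finset.mul_sum, ← Finset.sum_add_distrib]
    refine Finset.sum_congr rfl fun j _ ↦ ?_
    rw [hr (u i - u j)]
    simp only [sub_eq_zero]
    ring
  rw [hsum]
  have := mul_nonneg (sub_nonneg.2 h0) (sum_sum_ite_eq_nonneg b u)
  linarith

/-! ### Detecting an isolated frequency -/

open Real FourierTransform in
/-- There is a Schwartz function whose inverse Fourier transform equals `1` at `0` and is supported
in the unit ball. -/
theorem exists_schwartz_fourierInv_bump : ∃ ψ : SchwartzMap ℝ ℂ,
    (∫ w, ψ w) = 1 ∧
    ∀ x : ℝ, 1 ≤ |x| → ∫ w, ψ w * Complex.exp ((2 * π * w * x : ℝ) * Complex.I) = 0 := by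
  let f : ContDiffBump (0 : ℝ) := ⟨1 / 2, 1, by norm_num, by norm_num⟩
  have hs : HasCompactSupport fun x : ℝ ↦ (f x : ℂ) :=
    f.hasCompactSupport.comp_left (g := ((↑) : ℝ → ℂ)) Complex.ofReal_zero
  have hd : ContDiff ℝ (⊤ : ℕ∞) fun x : ℝ ↦ (f x : ℂ) :=
    Complex.ofRealCLM.contDiff.comp f.contDiff
  let φ : SchwartzMap ℝ ℂ := hs.toSchwartzMap hd
  have hφ : ∀ x, φ x = (f x : ℂ) := fun x ↦ rfl
  have key : ∀ x : ℝ, ∫ w, (𝓕 φ) w * Complex.exp ((2 * π * w * x : ℝ) * Complex.I) = f x := by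
    intro x
    have h : 𝓕⁻ (𝓕 φ) = φ := FourierTransform.fourierInv_fourier_eq φ
    have h2 := congrArg (fun g : SchwartzMap ℝ ℂ ↦ g x) h
    simp only [SchwartzMap.fourierInv_coe, hφ, Real.fourierInv_eq'] at h2
    rw [← h2]
    refine integral_congr_ae (ae_of_all _ fun w ↦ ?_)
    simp only [smul_eq_mul]
    rw [mul_comm]
    congr 4
    simp
    ring
  refine ⟨𝓕 φ, ?_, fun x hx ↦ ?_⟩
  · have := key 0
    simp only [mul_zero, Complex.ofReal_zero, zero_mul, Complex.exp_zero, mul_one] at this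
    rw [this, f.one_of_mem_closedBall (by simp [f])]
    simp
  · rw [key, f.zero_of_le_dist (by simpa [f] using hx)]
    simp

open Real in
/-- Uniform lower bound for the spectral norm of a trigonometric sum with one isolated frequency
of coefficient `1`, against a density bounded below by a power. -/
theorem exists_lower_bound_integral_mul_normSq {H c : ℝ} (hH0 : 0 < H) (hH1 : H < 1)
    (hc : 0 < c) : ∃ A : ℝ, 0 < A ∧ ∀ {ι : Type*} [Fintype ι] (R : ℝ → ℝ),
      (∀ w, c / (2 * π * |w| + 1) ^ (1 + 2 * H) ≤ R w) →
      ∀ (b u : ι → ℝ) (k : ι), b k = 1 → ∀ δ : ℝ, 0 < δ → δ ≤ 1 →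
      (∀ i, i ≠ k → δ ≤ |u i - u k|) →
      Integrable (fun w : ℝ ↦ R w *
        ‖∑ i, (b i : ℂ) * Complex.exp ((2 * π * w * u i : ℝ) * Complex.I)‖ ^ 2) →
      δ ^ (2 * H) / A ≤ ∫ w, R w *
        ‖∑ i, (b i : ℂ) * Complex.exp ((2 * π * w * u i : ℝ) * Complex.I)‖ ^ 2 := by
  obtain ⟨ψ, hψ1, hψ0⟩ := exists_schwartz_fourierInv_bump
  -- The integer exponent 3 dominates `1 + 2 * H`, as `H < 1`.
  have hwt : Integrable fun w : ℝ ↦ ‖ψ w‖ ^ 2 * (2 * π * |w| + 1) ^ 3 := by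
    obtain ⟨C, hC⟩ : ∃ C, ∀ w, ‖ψ w‖ ≤ C := by
      obtain ⟨C, -, hC⟩ := ψ.decay 0 0
      exact ⟨C, fun w ↦ by simpa using hC w⟩
    have hp : ∀ n : ℕ, Integrable fun w : ℝ ↦ |w| ^ n * ‖ψ w‖ := fun n ↦
      ψ.integrable_pow_mul volume n
    have h := (((hp 3).const_mul ((2 * π) ^ 3)).add (((hp 2).const_mul (3 * (2 * π) ^ 2)).add
      (((hp 1).const_mul (3 * (2 * π))).add (hp 0)))).mul_bdd (c := C) (g := fun w ↦ ‖ψ w‖)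
      ψ.continuous.norm.aestronglyMeasurable (ae_of_all _ fun w ↦ by simpa using hC w)
    refine h.congr (ae_of_all _ fun w ↦ ?_)
    simp only [Pi.add_apply]
    ring
  let A := c⁻¹ * ∫ w, ‖ψ w‖ ^ 2 * (2 * π * |w| + 1) ^ 3
  have hA0 : 0 ≤ A := by
    refine mul_nonneg (inv_pos.2 hc).le (integral_nonneg fun w ↦ ?_)
    have := pi_pos
    positivity
  -- Adding 1 avoids proving `A` strictly positive.
  refine ⟨A + 1, by linarith, ?_⟩
  intro ι _ R hR b u k hbk δ hδ0 hδ1 hsep hint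
  set S : ℝ → ℂ := fun w ↦ ∑ i, (b i : ℂ) * Complex.exp ((2 * π * w * u i : ℝ) * Complex.I)
    with hS
  set Q := ∫ w, R w * ‖S w‖ ^ 2 with hQ
  -- the isolated frequency is detected by the test function
  have hdet : ∫ w, ψ w * (Complex.exp (-(2 * π * (w / δ) * u k : ℝ) * Complex.I) * S (w / δ))
      = 1 := by
    have hexp : ∀ w, ψ w * (Complex.exp (-(2 * π * (w / δ) * u k : ℝ) * Complex.I) * S (w / δ))
        = ∑ i, (b i : ℂ) *
          (ψ w * Complex.exp ((2 * π * w * ((u i - u k) / δ) : ℝ) * Complex.I)) := by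
      intro w
      simp only [hS, Finset.mul_sum]
      refine Finset.sum_congr rfl fun i _ ↦ ?_
      have : Complex.exp ((2 * π * w * ((u i - u k) / δ) : ℝ) * Complex.I)
          = Complex.exp (-(2 * π * (w / δ) * u k : ℝ) * Complex.I) *
            Complex.exp ((2 * π * (w / δ) * u i : ℝ) * Complex.I) := by
        rw [← Complex.exp_add]
        congr 1
        push_cast
        ring
      rw [this]
      ring
    have hi : ∀ x : ℝ, Integrable fun w ↦ ψ w * Complex.exp ((2 * π * w * x : ℝ) * Complex.I) := by
      intro x
      refine ψ.integrable.mul_bdd (c := 1) (by fun_prop) (ae_of_all _ fun w ↦ ?_)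
      rw [Complex.norm_exp_ofReal_mul_I]
    simp_rw [hexp]
    rw [integral_finsetSum _ fun i _ ↦ (hi _).const_mul _]
    simp_rw [integral_const_mul]
    rw [Finset.sum_eq_single k]
    · simp [hbk, hψ1]
    · intro i _ hik
      rw [hψ0, mul_zero]
      rw [abs_div, abs_of_pos hδ0, le_div_iff₀ hδ0, one_mul]
      exact hsep i hik
    · simp
  have hpos : ∀ w : ℝ, 0 < 2 * π * |w| + 1 := fun w ↦ by positivity
  have hRpos : ∀ w, 0 < R w := fun w ↦
    (div_pos hc (rpow_pos_of_pos (hpos w) _)).trans_le (hR w)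
  have hδp : 0 < δ ^ (1 + 2 * H) := rpow_pos_of_pos hδ0 _
  have hinvR : ∀ w, (R (w / δ))⁻¹ ≤ c⁻¹ * (δ ^ (1 + 2 * H))⁻¹ * (2 * π * |w| + 1) ^ 3 := by
    intro w
    have h1 : (R (w / δ))⁻¹ ≤ (c / (2 * π * |w / δ| + 1) ^ (1 + 2 * H))⁻¹ :=
      inv_anti₀ (div_pos hc (rpow_pos_of_pos (hpos _) _)) (hR _)
    have h2 : 2 * π * |w / δ| + 1 ≤ (2 * π * |w| + 1) / δ := by
      rw [abs_div, abs_of_pos hδ0, add_div, mul_div_assoc]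
      gcongr
      exact (one_le_div hδ0).2 hδ1
    have h3 : (2 * π * |w / δ| + 1) ^ (1 + 2 * H)
        ≤ (δ ^ (1 + 2 * H))⁻¹ * (2 * π * |w| + 1) ^ 3 := by
      calc (2 * π * |w / δ| + 1) ^ (1 + 2 * H) ≤ ((2 * π * |w| + 1) / δ) ^ (1 + 2 * H) :=
            rpow_le_rpow (hpos _).le h2 (by linarith)
        _ = (δ ^ (1 + 2 * H))⁻¹ * (2 * π * |w| + 1) ^ (1 + 2 * H) := by
            rw [div_rpow (hpos w).le hδ0.le]; ring
        _ ≤ _ := by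
            refine mul_le_mul_of_nonneg_left ?_ (inv_pos.2 hδp).le
            rw [← rpow_natCast]
            refine rpow_le_rpow_of_exponent_le ?_ (by push_cast; linarith)
            have := mul_nonneg (mul_nonneg two_pos.le pi_pos.le) (abs_nonneg w)
            linarith
    calc _ ≤ _ := h1
      _ = c⁻¹ * (2 * π * |w / δ| + 1) ^ (1 + 2 * H) := by rw [inv_div]; ring
      _ ≤ c⁻¹ * ((δ ^ (1 + 2 * H))⁻¹ * (2 * π * |w| + 1) ^ 3) :=
        mul_le_mul_of_nonneg_left h3 (inv_pos.2 hc).le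
      _ = _ := by ring
  -- Weight for `pq ≤ θp²/(2R) + Rq²/(2θ)`, which replaces Cauchy-Schwarz; with this choice the
  -- first term integrates to at most 1/2.
  set θ := δ ^ (1 + 2 * H) / (A + 1) with hθ
  have hθ0 : 0 < θ := div_pos hδp (by linarith)
  have hint2 : Integrable fun w ↦ R (w / δ) * ‖S (w / δ)‖ ^ 2 := by
    exact hint.comp_div hδ0.ne'
  have hQs : ∫ w, R (w / δ) * ‖S (w / δ)‖ ^ 2 = δ * Q := by
    have := Measure.integral_comp_div (fun w ↦ R w * ‖S w‖ ^ 2) δ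
    rw [this, abs_of_pos hδ0, smul_eq_mul]
  have hmain : (1 : ℝ) ≤ ∫ w, (θ / 2 * (c⁻¹ * (δ ^ (1 + 2 * H))⁻¹ *
      (‖ψ w‖ ^ 2 * (2 * π * |w| + 1) ^ 3)) + θ⁻¹ / 2 * (R (w / δ) * ‖S (w / δ)‖ ^ 2)) := by
    refine (show (1 : ℝ) = ‖∫ w, ψ w * (Complex.exp (-(2 * π * (w / δ) * u k : ℝ) * Complex.I) *
      S (w / δ))‖ by rw [hdet]; simp).trans_le ?_
    refine norm_integral_le_of_norm_le (((hwt.const_mul _).const_mul _).add (hint2.const_mul _))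
      (ae_of_all _ fun w ↦ ?_)
    rw [norm_mul, norm_mul, ← Complex.ofReal_neg, Complex.norm_exp_ofReal_mul_I, one_mul]
    set p := ‖ψ w‖
    set q := ‖S (w / δ)‖
    have hRw := hRpos (w / δ)
    have h1 : p * q ≤ θ / 2 * ((R (w / δ))⁻¹ * p ^ 2) + θ⁻¹ / 2 * (R (w / δ) * q ^ 2) := by
      have h2 : θ / 2 * ((R (w / δ))⁻¹ * p ^ 2) + θ⁻¹ / 2 * (R (w / δ) * q ^ 2) - p * q
          = θ / 2 * (R (w / δ))⁻¹ * (p - θ⁻¹ * R (w / δ) * q) ^ 2 := by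
        field_simp
        ring
      have h3 : 0 ≤ θ / 2 * (R (w / δ))⁻¹ * (p - θ⁻¹ * R (w / δ) * q) ^ 2 := by positivity
      linarith
    have h4 : θ / 2 * ((R (w / δ))⁻¹ * p ^ 2) ≤ θ / 2 * (c⁻¹ * (δ ^ (1 + 2 * H))⁻¹ *
      (p ^ 2 * (2 * π * |w| + 1) ^ 3)) := by
      refine mul_le_mul_of_nonneg_left ?_ (by positivity)
      calc _ ≤ c⁻¹ * (δ ^ (1 + 2 * H))⁻¹ * (2 * π * |w| + 1) ^ 3 * p ^ 2 :=
            mul_le_mul_of_nonneg_right (hinvR w) (sq_nonneg _)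
        _ = _ := by ring
    linarith
  rw [integral_add ((hwt.const_mul _).const_mul _) (hint2.const_mul _), integral_const_mul,
    integral_const_mul, integral_const_mul, hQs] at hmain
  have hfirst : θ / 2 * (c⁻¹ * (δ ^ (1 + 2 * H))⁻¹ *
      ∫ w, ‖ψ w‖ ^ 2 * (2 * π * |w| + 1) ^ 3) = A / (2 * (A + 1)) := by
    rw [hθ]
    change _ = (c⁻¹ * ∫ w, ‖ψ w‖ ^ 2 * (2 * π * |w| + 1) ^ 3) / (2 * (A + 1))
    field_simp
  have hsecond : θ⁻¹ / 2 * (δ * Q) = (A + 1) / (2 * δ ^ (2 * H)) * Q := by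
    rw [hθ, rpow_add hδ0, rpow_one]
    field_simp
  rw [hfirst, hsecond] at hmain
  have hA1 : A / (2 * (A + 1)) ≤ 1 / 2 := by
    rw [div_le_div_iff₀ (by linarith) (by norm_num)]; linarith
  have hδ2 : 0 < δ ^ (2 * H) := rpow_pos_of_pos hδ0 _
  rw [div_le_iff₀ (by linarith)]
  have h5 : 1 / 2 ≤ (A + 1) / (2 * δ ^ (2 * H)) * Q := by linarith
  have h6 : (A + 1) / (2 * δ ^ (2 * H)) * Q = (Q * (A + 1)) / (2 * δ ^ (2 * H)) := by ring
  rw [h6, div_le_div_iff₀ (by norm_num) (by positivity)] at h5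
  linarith

/-! ### Gaussian conditional variance -/

/-- A square integrable random variable splits into a linear combination of finitely many given
ones and a remainder orthogonal to all of them. -/
theorem exists_orthogonal_residual {Ω : Type*} [MeasurableSpace Ω] {P : Measure Ω} {ι : Type*}
    [Fintype ι] {X : Ω → ℝ} {Y : ι → Ω → ℝ} (hX : MemLp X 2 P) (hY : ∀ i, MemLp (Y i) 2 P) :
    ∃ a : ι → ℝ, ∀ j, ∫ ω, (X ω - ∑ i, a i * Y i ω) * Y j ω ∂P = 0 := by
  let y : ι → Lp ℝ 2 P := fun i ↦ (hY i).toLp (Y i)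
  let K : Submodule ℝ (Lp ℝ 2 P) := Submodule.span ℝ (Set.range y)
  have : FiniteDimensional ℝ K := FiniteDimensional.span_of_finite ℝ (Set.finite_range y)
  let x : Lp ℝ 2 P := hX.toLp X
  obtain ⟨a, ha⟩ := (Submodule.mem_span_range_iff_exists_fun ℝ).1 (K.starProjection_apply_mem x)
  refine ⟨a, fun j ↦ ?_⟩
  have h1 : inner ℝ (x - K.starProjection x) (y j) = 0 :=
    K.starProjection_inner_eq_zero x (y j) (Submodule.subset_span ⟨j, rfl⟩)
  rw [← ha, L2.inner_def] at h1
  rw [← h1]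
  have hsum : ((∑ i, a i • y i : Lp ℝ 2 P) : Ω → ℝ) =ᵐ[P] fun ω ↦ ∑ i, a i * Y i ω := by
    have h2 : ∀ᵐ ω ∂P, ∀ i, (a i • y i : Lp ℝ 2 P) ω = a i * Y i ω := by
      rw [ae_all_iff]
      intro i
      filter_upwards [Lp.coeFn_smul (a i) (y i), (hY i).coeFn_toLp] with ω h3 h4
      rw [h3, Pi.smul_apply, h4, smul_eq_mul]
    filter_upwards [Lp.coeFn_finsetSum Finset.univ (fun i ↦ a i • y i), h2] with ω h3 h4
    rw [h3, Finset.sum_apply]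
    exact Finset.sum_congr rfl fun i _ ↦ h4 i
  refine integral_congr_ae ?_
  filter_upwards [Lp.coeFn_sub x (∑ i, a i • y i), hX.coeFn_toLp, (hY j).coeFn_toLp, hsum]
    with ω h3 h4 h5 h6
  simp only [y, x] at *
  rw [h3, h5, Pi.sub_apply, h4, h6]
  simp [mul_comm]

/-- The conditional variance of a centered Gaussian process at `t` given its values at finitely many
times is the variance of some combination `Z_t - ∑ a_j Z_{s_j}`. -/
theorem IsGaussianProcess.exists_condVar_ae_eq {Ω T : Type*} {mΩ : MeasurableSpace Ω} {P : Measure Ω}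
    [IsProbabilityMeasure P] {Z : T → Ω → ℝ} (hZ : IsGaussianProcess Z P)
    (hm : ∀ t, Measurable (Z t)) (h0 : ∀ t, ∫ ω, Z t ω ∂P = 0) {ι : Type*} [Fintype ι]
    (s : ι → T) (t : T) :
    ∃ a : ι → ℝ, condVar (⨆ j, MeasurableSpace.comap (Z (s j)) inferInstance) (Z t) P
      =ᵐ[P] fun _ ↦ ∫ ω, (Z t ω - ∑ j, a j * Z (s j) ω) ^ 2 ∂P := by
  classical
  have hL2 : ∀ t, MemLp (Z t) 2 P := fun t ↦ (hZ.hasGaussianLaw_eval t).memLp_two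
  obtain ⟨a, ha⟩ := exists_orthogonal_residual (hL2 t) fun j ↦ hL2 (s j)
  refine ⟨a, ?_⟩
  set W : Ω → ℝ := fun ω ↦ Z t ω - ∑ j, a j * Z (s j) ω with hW
  have hWm : Measurable W :=
    (hm t).sub (Finset.measurable_fun_sum _ fun j _ ↦ (hm (s j)).const_mul (a j))
  have hsumL2 : MemLp (fun ω ↦ ∑ j, a j * Z (s j) ω) 2 P :=
    memLp_finsetSum _ fun j _ ↦ (hL2 (s j)).const_mul (a j)
  have hWL2 : MemLp W 2 P := (hL2 t).sub hsumL2
  have hZint : ∀ t, Integrable (Z t) P := fun t ↦ (hL2 t).integrable (by norm_num)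
  have hsumint : Integrable (fun ω ↦ ∑ j, a j * Z (s j) ω) P := hsumL2.integrable (by norm_num)
  have hW0 : ∫ ω, W ω ∂P = 0 := by
    rw [hW, integral_sub (hZint t) hsumint,
      integral_finsetSum _ fun j _ ↦ (hZint (s j)).const_mul (a j)]
    simp [integral_const_mul, h0]
  have hjoint : IsGaussianProcess (Sum.elim (fun _ : Unit ↦ W) fun j ↦ Z (s j)) P := by
    refine hZ.of_isGaussianProcess fun i ↦ ?_
    rcases i with _ | j
    · refine ⟨insert t (Finset.univ.image s),
        .proj ⟨t, by simp⟩ - ∑ j, a j • .proj ⟨s j, by simp⟩, fun ω ↦ ?_⟩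
      simp [hW]
    · exact ⟨{s j}, .proj ⟨s j, by simp⟩, fun ω ↦ by simp⟩
  -- Jointly Gaussian and uncorrelated implies independent, so conditioning does not affect `W`.
  have hindep : IndepFun (fun ω (_ : Unit) ↦ W ω) (fun ω j ↦ Z (s j) ω) P := by
    refine hjoint.indepFun_of_covariance_eq_zero (fun _ ↦ hWm.aemeasurable)
      (fun j ↦ (hm (s j)).aemeasurable) fun _ j ↦ ?_
    rw [covariance_eq_sub hWL2 (hL2 (s j)), h0, mul_zero, sub_zero]
    exact ha j
  set m : MeasurableSpace Ω := ⨆ j, MeasurableSpace.comap (Z (s j)) inferInstance with hmdef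
  have hmle : m ≤ mΩ := iSup_le fun j ↦ (hm (s j)).comap_le
  have hind : Indep (MeasurableSpace.comap W inferInstance) m P := by
    have h1 : IndepFun W (fun ω j ↦ Z (s j) ω) P :=
      hindep.comp (φ := fun f : Unit → ℝ ↦ f ()) (ψ := id) (measurable_pi_apply ()) measurable_id
    have h2 : m = MeasurableSpace.comap (fun ω j ↦ Z (s j) ω) inferInstance := by
      rw [hmdef, MeasurableSpace.pi, MeasurableSpace.comap_iSup]
      simp [MeasurableSpace.comap_comp, Function.comp_def]
    rw [h2]
    exact h1
  have hWc : StronglyMeasurable[MeasurableSpace.comap W inferInstance] W :=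
    (comap_measurable W).stronglyMeasurable
  have hsumm : StronglyMeasurable[m] fun ω ↦ ∑ j, a j * Z (s j) ω := by
    refine Measurable.stronglyMeasurable (Finset.measurable_fun_sum _ fun j _ ↦ ?_)
    refine Measurable.const_mul ?_ _
    exact (comap_measurable (Z (s j))).mono (le_iSup (fun j ↦ MeasurableSpace.comap (Z (s j))
      inferInstance) j) le_rfl
  have hcW : P[W | m] =ᵐ[P] fun _ ↦ 0 := by
    have := condExp_indep_eq hWm.comap_le hmle hWc hind
    rwa [hW0] at this
  have hcZ : P[Z t | m] =ᵐ[P] fun ω ↦ ∑ j, a j * Z (s j) ω := by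
    have h1 : Z t = W + fun ω ↦ ∑ j, a j * Z (s j) ω := by ext ω; simp [hW]
    have h2 := condExp_add (hWL2.integrable (by norm_num)) hsumint m
    rw [← h1, condExp_of_stronglyMeasurable hmle hsumm hsumint] at h2
    filter_upwards [h2, hcW] with ω h3 h4
    rw [h3, Pi.add_apply, h4, zero_add]
  have hsq : condVar m (Z t) P =ᵐ[P] P[fun ω ↦ W ω ^ 2 | m] := by
    refine condExp_congr_ae ?_
    filter_upwards [hcZ] with ω h1
    simp [h1, hW]
  refine hsq.trans ?_
  exact condExp_indep_eq hWm.comap_le hmle (hWc.pow 2) hind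

/-! ### Covariances under self-similarity -/

section SelfSimilar

variable {Ω : Type*} [MeasurableSpace Ω] {P : Measure Ω} {H : ℝ} {Z : ℝ≥0 → Ω → ℝ}

theorem IsSelfSimilar.integral_mul (hZ : IsSelfSimilar H Z P) {a : ℝ≥0} (ha : 0 < a)
    (s t : ℝ≥0) :
    ∫ ω, Z (a * s) ω * Z (a * t) ω ∂P = (a : ℝ) ^ H * (a : ℝ) ^ H * ∫ ω, Z s ω * Z t ω ∂P := by
  classical
  let I : Finset ℝ≥0 := {s, t}
  let u : (I → ℝ) → ℝ := fun x ↦ x ⟨s, by simp [I]⟩ * x ⟨t, by simp [I]⟩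
  have hu : Measurable u := (measurable_pi_apply _).mul (measurable_pi_apply _)
  have h := ((hZ a ha I).comp hu).integral_eq
  simp only [u, Function.comp_def, Finset.restrict] at h
  rw [h, ← integral_const_mul]
  congr 1
  ext ω
  ring

/-- Scaling by `s` reduces the pair `(s, t)` to `(1, t / s)`: this is stationarity of the Lamperti
transform. -/
theorem IsSelfSimilar.integral_mul_eq_lampertiCov (hZ : IsSelfSimilar H Z P) {s t : ℝ≥0}
    (hs : 0 < s) (ht : 0 < t) :
    ∫ ω, Z s ω * Z t ω ∂P
      = (s : ℝ) ^ H * (t : ℝ) ^ H * lampertiCov H Z P (Real.log t - Real.log s) := by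
  have hs' : (0 : ℝ) < s := hs
  have ht' : (0 : ℝ) < t := ht
  set x := Real.log t - Real.log s with hx
  have hexp : Real.exp x = t / s := by
    rw [hx, Real.exp_sub, Real.exp_log ht', Real.exp_log hs']
  have hmk : ∀ y : ℝ, (⟨Real.exp y, (Real.exp_pos y).le⟩ : ℝ≥0) = (Real.exp y).toNNReal :=
    fun y ↦ (Real.toNNReal_of_nonneg (Real.exp_pos y).le).symm
  have hcov : lampertiCov H Z P x
      = Real.exp (-H * x) * ∫ ω, Z 1 ω * Z (Real.exp x).toNNReal ω ∂P := by
    rw [lampertiCov, ← integral_const_mul]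
    refine integral_congr_ae (ae_of_all _ fun ω ↦ ?_)
    have h0 : lamperti H Z 0 ω = Z 1 ω := by
      rw [lamperti, hmk]
      simp
    beta_reduce
    rw [h0, lamperti, hmk]
    ring
  have h := hZ.integral_mul hs 1 (Real.exp x).toNNReal
  have ht2 : s * (Real.exp x).toNNReal = t := by
    ext
    rw [NNReal.coe_mul, Real.coe_toNNReal _ (Real.exp_pos x).le, hexp]
    field_simp
  rw [mul_one, ht2] at h
  rw [h, hcov]
  have h1 : (t : ℝ) ^ H * Real.exp (-H * x) = (s : ℝ) ^ H := by
    rw [Real.rpow_def_of_pos ht', Real.rpow_def_of_pos hs', ← Real.exp_add, hx]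
    congr 1
    ring
  rw [← h1]
  ring

/-- Both sides come from the symmetric moment `E[Z_1 Z_{e^x}]`, read in its two orders. -/
theorem IsSelfSimilar.lampertiCov_neg (hZ : IsSelfSimilar H Z P) (x : ℝ) :
    lampertiCov H Z P (-x) = lampertiCov H Z P x := by
  let t : ℝ≥0 := ⟨Real.exp x, (Real.exp_pos x).le⟩
  have ht : 0 < t := Real.exp_pos x
  have h1 := hZ.integral_mul_eq_lampertiCov (one_pos) ht
  have h2 := hZ.integral_mul_eq_lampertiCov ht one_pos
  simp_rw [mul_comm (Z t _)] at h2
  rw [h1] at h2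
  have hl : Real.log t = x := Real.log_exp x
  have htp : (t : ℝ) ^ H ≠ 0 := (Real.rpow_pos_of_pos (Real.exp_pos x) H).ne'
  simp only [hl, NNReal.coe_one, Real.log_one, sub_zero, zero_sub, Real.one_rpow, one_mul,
    mul_one] at h2
  exact (mul_left_cancel₀ htp h2).symm

end SelfSimilar

/-- The second moment of a linear combination of a self-similar process, in terms of the covariance
function of its Lamperti transform. -/
theorem IsSelfSimilar.integral_sum_sq {Ω : Type*} [MeasurableSpace Ω] {P : Measure Ω} {H : ℝ}
    {Z : ℝ≥0 → Ω → ℝ} (hZ : IsSelfSimilar H Z P) (hL2 : ∀ t, MemLp (Z t) 2 P) {ι : Type*}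
    [Fintype ι] (β : ι → ℝ) {τ : ι → ℝ≥0} (hτ : ∀ i, 0 < τ i) :
    ∫ ω, (∑ i, β i * Z (τ i) ω) ^ 2 ∂P = ∑ i, ∑ j, (β i * (τ i : ℝ) ^ H) * (β j * (τ j : ℝ) ^ H) *
      lampertiCov H Z P (Real.log (τ i) - Real.log (τ j)) := by
  have hi : ∀ i j, Integrable (fun ω ↦ β i * β j * (Z (τ i) ω * Z (τ j) ω)) P := fun i j ↦
    ((hL2 (τ i)).integrable_mul (hL2 (τ j))).const_mul _
  have hexp : ∀ ω, (∑ i, β i * Z (τ i) ω) ^ 2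
      = ∑ i, ∑ j, β i * β j * (Z (τ i) ω * Z (τ j) ω) := by
    intro ω
    rw [sq, Finset.sum_mul_sum]
    refine Finset.sum_congr rfl fun i _ ↦ Finset.sum_congr rfl fun j _ ↦ ?_
    ring
  simp_rw [hexp]
  rw [integral_finsetSum _ fun i _ ↦ integrable_finsetSum _ fun j _ ↦ hi i j]
  refine Finset.sum_congr rfl fun i _ ↦ ?_
  rw [integral_finsetSum _ fun j _ ↦ hi i j]
  refine Finset.sum_congr rfl fun j _ ↦ ?_
  rw [integral_const_mul, hZ.integral_mul_eq_lampertiCov (hτ i) (hτ j), ← hZ.lampertiCov_neg,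
    neg_sub]
  ring

/-! ### From separated times to the variance bound -/

/-- Logarithms of times at relative distance at least `2 * δ` are `δ`-separated. -/
theorem le_abs_log_sub_log {s t δ : ℝ} (hs : 0 < s) (ht : 0 < t) (hδ : δ ≤ 1)
    (h : 2 * t * δ ≤ |t - s|) : δ ≤ |Real.log s - Real.log t| := by
  by_contra! hlt
  -- `|e^x - 1| ≤ 2|x|` for `|x| ≤ 1` is the source of the factor 2.
  have h1 := Real.abs_exp_sub_one_le (hlt.le.trans hδ)
  rw [Real.exp_sub, Real.exp_log hs, Real.exp_log ht] at h1
  have h2 : |t - s| = t * |s / t - 1| := by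
    rw [abs_sub_comm, div_sub_one ht.ne', abs_div, abs_of_pos ht, mul_div_cancel₀ _ ht.ne']
  have h3 := mul_le_mul_of_nonneg_left h1 ht.le
  have h4 := mul_lt_mul_of_pos_left hlt ht
  linarith

theorem theorem6p1 (H : ℝ) (hH0 : 0 < H) (hH1 : H < 1) (c : ℝ) (hc : 0 < c) :
    ∃ κ : ℝ, 0 < κ ∧
      ∀ {Ω : Type*} [MeasurableSpace Ω] (P : Measure Ω) [IsProbabilityMeasure P]
        (Z : ℝ≥0 → Ω → ℝ),
        (∀ t, Measurable (Z t)) →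
        IsGaussianProcess Z P →
        (∀ t, ∫ ω, Z t ω ∂P = 0) →
        IsSelfSimilar H Z P →
        (∀ t : ℝ, 0 ≤ t → 0 ≤ lampertiCov H Z P t) →
        AntitoneOn (lampertiCov H Z P) (Set.Ici 0) →
        Integrable (lampertiCov H Z P) volume →
        (∀ ξ : ℝ, c / (|ξ| + 1) ^ (1 + 2 * H) ≤
          ∫ t in Set.Ioi (0 : ℝ), lampertiCov H Z P t * Real.cos (t * ξ)) →
        ∀ (m : ℕ), 1 ≤ m → ∀ (s : Fin m → ℝ≥0) (t : ℝ≥0), (∀ j, 0 < s j) → 0 < t →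
          ∀ᵐ ω ∂P,
            κ * min (⨅ j : Fin m, |(t : ℝ) - (s j : ℝ)| ^ (2 * H)) ((t : ℝ) ^ (2 * H)) ≤
              condVar (sigmaGenerated Z s) (Z t) P ω := by
  obtain ⟨A, hA, hbound⟩ := exists_lower_bound_integral_mul_normSq hH0 hH1 hc
  have h2H : 0 < 2 * H := by linarith
  refine ⟨1 / (A * 2 ^ (2 * H)), by positivity, ?_⟩
  intro Ω _ P _ Z hZm hZG hZ0 hZs hr0 hanti hint hcos m hm s t hs ht
  obtain ⟨a, ha⟩ := IsGaussianProcess.exists_condVar_ae_eq hZG hZm hZ0 s t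
  filter_upwards [ha] with ω hω
  change _ ≤ condVar (⨆ j, MeasurableSpace.comap (Z (s j)) inferInstance) (Z t) P ω
  rw [hω]
  clear hω ha
  have hmne : Nonempty (Fin m) := ⟨⟨0, hm⟩⟩
  have ht' : (0 : ℝ) < t := ht
  set M := min (⨅ j : Fin m, |(t : ℝ) - (s j : ℝ)| ^ (2 * H)) ((t : ℝ) ^ (2 * H)) with hM
  have hMs : ∀ j, M ≤ |(t : ℝ) - (s j : ℝ)| ^ (2 * H) := fun j ↦
    (min_le_left _ _).trans (ciInf_le (Set.finite_range _).bddBelow j)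
  have hMt : M ≤ (t : ℝ) ^ (2 * H) := min_le_right _ _
  have hsq : 0 ≤ ∫ ω, (Z t ω - ∑ j, a j * Z (s j) ω) ^ 2 ∂P :=
    integral_nonneg fun ω ↦ sq_nonneg _
  -- The degenerate case, such as `t = s j`, is trivial.
  rcases le_or_gt M 0 with hM0 | hM0
  · exact (mul_nonpos_of_nonneg_of_nonpos (by positivity) hM0).trans hsq
  have hroot : ∀ x : ℝ, 0 ≤ x → M ≤ x ^ (2 * H) → M ^ (2 * H)⁻¹ ≤ x := fun x hx h ↦
    (Real.rpow_inv_le_iff_of_pos hM0.le hx h2H).2 h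
  -- The largest `δ` allowed by `le_abs_log_sub_log`; the term `t^{2H}` in the minimum ensures `δ ≤
  -- 1`.
  set δ := M ^ (2 * H)⁻¹ / (2 * t) with hδ
  have hδ0 : 0 < δ := by positivity
  have hδM : 2 * t * δ = M ^ (2 * H)⁻¹ := by rw [hδ]; field_simp
  have hδ1 : δ ≤ 1 := by
    have := hroot t ht'.le hMt
    rw [hδ, div_le_one (by positivity)]
    linarith
  have hMδ : M = 2 ^ (2 * H) * ((t : ℝ) ^ (2 * H) * δ ^ (2 * H)) := by
    rw [← Real.mul_rpow ht'.le hδ0.le, ← Real.mul_rpow (by norm_num) (by positivity),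
      ← mul_assoc, hδM, Real.rpow_inv_rpow hM0.le h2H.ne']
  -- the residual as a linear combination of values of the process
  let τ : Option (Fin m) → ℝ≥0 := fun i ↦ i.elim t s
  let β : Option (Fin m) → ℝ := fun i ↦ i.elim 1 fun j ↦ -a j
  have hτ : ∀ i, 0 < τ i := by
    rintro (_ | j)
    · exact ht
    · exact hs j
  let u : Option (Fin m) → ℝ := fun i ↦ Real.log (τ i)
  let b : Option (Fin m) → ℝ := fun i ↦ β i * (τ i : ℝ) ^ H / (t : ℝ) ^ H
  have hL2 : ∀ t, MemLp (Z t) 2 P := fun t ↦ (hZG.hasGaussianLaw_eval t).memLp_two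
  have htH : (0 : ℝ) < (t : ℝ) ^ H := Real.rpow_pos_of_pos ht' H
  have hvar : ∫ ω, (Z t ω - ∑ j, a j * Z (s j) ω) ^ 2 ∂P
      = (t : ℝ) ^ (2 * H) * ∑ i, ∑ j, b i * b j * lampertiCov H Z P (u i - u j) := by
    have h1 : ∀ ω, Z t ω - ∑ j, a j * Z (s j) ω = ∑ i, β i * Z (τ i) ω := by
      intro ω
      simp [Fintype.sum_option, β, τ, sub_eq_add_neg]
    simp_rw [h1]
    rw [hZs.integral_sum_sq hL2 β hτ, Finset.mul_sum]
    refine Finset.sum_congr rfl fun i _ ↦ ?_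
    rw [Finset.mul_sum]
    refine Finset.sum_congr rfl fun j _ ↦ ?_
    rw [two_mul, Real.rpow_add ht']
    simp only [b, u]
    field_simp
  -- the spectral lower bound
  have hcosn : ∀ ξ : ℝ, 0 ≤ ∫ t in Set.Ioi (0 : ℝ), lampertiCov H Z P t * Real.cos (t * ξ) :=
    fun ξ ↦ (by positivity : 0 ≤ c / (|ξ| + 1) ^ (1 + 2 * H)).trans (hcos ξ)
  obtain ⟨hR, hR0, hRr⟩ :=
    fourier_inversion_of_antitoneOn hZs.lampertiCov_neg hr0 hanti hint hcosn
  obtain ⟨hQint, hQ⟩ := integral_mul_normSq_le_quadraticForm hR hR0 hRr b u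
  -- The density is twice the cosine integral, so the hypothesis bounds it with a factor 2 to spare.
  have hlow := hbound _ (fun w ↦ by
    have h1 := hcos (2 * Real.pi * w)
    rw [abs_mul, abs_of_pos Real.two_pi_pos] at h1
    have h2 := hcosn (2 * Real.pi * w)
    linarith) b u none (by simp [b, β, τ, htH.ne']) δ hδ0 hδ1 (by
    rintro (_ | j) hj
    · exact absurd rfl hj
    · exact le_abs_log_sub_log (hs j) ht' hδ1
        (hδM.le.trans (hroot _ (abs_nonneg _) (hMs j)))) hQint
  rw [hvar]
  calc 1 / (A * 2 ^ (2 * H)) * M = (t : ℝ) ^ (2 * H) * (δ ^ (2 * H) / A) := by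
        rw [hMδ]
        field_simp
    _ ≤ _ := mul_le_mul_of_nonneg_left (hlow.trans hQ) (by positivity)
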